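/- Let $k\ge 1$ be an integer and let $G$ be a finite simple graph. For $n\ge |V(G)|$ let $\mathrm{AR}_k(n,G)$ denote the smallest integer $r$ such that every edge coloring of the complete graph $K_n$ using at least $r$ colors contains a copy of $G$ in which no color occurs on more than $k$ edges. Let $\mathcal{F}_k$ be the family of graphs with at most $k$ edges, and let $\chi_{\mathcal{F}_k}(G)=\min\{\chi(G-D): D\subseteq G,\ D\in\mathcal{F}_k\}$, where $\chi$ is the chromatic number and $G-D$ is obtained from $G$ by deleting the edges of $D$. Let $\mathrm{ex}(n,H)$ denote the maximum number of edges of a graph on $n$ vertices that contains no subgraph isomorphic to $H$. As $n\to\infty$ (with $k$ and $G$ fixed), the following hold. (i) If $G$ cannot be made bipartite by the omission of at most $k$ edges, then $$\mathrm{AR}_k(n,G)=(1+o(1))\,\mathrm{ex}\bigl(n,K_{\chi_{\mathcal{F}_k}(G)}\bigr).$$ (ii) If $\chi(G)=q\ge 3$ and the complete $q$-partite graph $K_{k+1,\dots,k+1}$ (with $q$ parts of size $k+1$) is a subgraph of $G$, then $$\mathrm{AR}_k(n,G)=(1+o(1))\,\mathrm{ex}(n,K_q)=(1+o(1))\,\frac{q-2}{2q-2}\,n^2.$$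 -/

import Mathlib

open Filter Asymptotics

/-- The family of graphs (here: on a given vertex set) that have at most `k` edges. -/
def atMostEdges (k : ℕ) (V : Type*) : Set (SimpleGraph V) :=
  {D | D.edgeSet.encard ≤ k}

/-- The deck of `G` with respect to a family `F` of graphs: all graphs `G - D`, obtained from `G` by
deleting the edges of a subgraph `D` of `G` that belongs to `F`. -/
def deck {V : Type*} (F : Set (SimpleGraph V)) (G : SimpleGraph V) : Set (SimpleGraph V) :=
  {H | ∃ D ∈ F, D ≤ G ∧ H = G \ D}

/-- The reduced chromatic number of `G` with respect to `F`: the minimum of the chromatic numbers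
of the members of the deck. -/
noncomputable def reducedChromaticNumber {V : Type*} (F : Set (SimpleGraph V))
    (G : SimpleGraph V) : ℕ :=
  sInf {m : ℕ | ∃ H ∈ deck F G, H.chromaticNumber = m}

/-- For a finite graph and the family of graphs with at most `k` edges, the minimum is attained. -/
theorem reducedChromaticNumber_attained {V : Type*} [Finite V] (k : ℕ) (G : SimpleGraph V) :
    ∃ H ∈ deck (atMostEdges k V) G,
      H.chromaticNumber = reducedChromaticNumber (atMostEdges k V) G := by
  have hne : {m : ℕ | ∃ H ∈ deck (atMostEdges k V) G, H.chromaticNumber = m}.Nonempty := by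
    have hG : G.chromaticNumber ≠ ⊤ := by
      have := Fintype.ofFinite V
      exact SimpleGraph.chromaticNumber_ne_top_iff_exists.2 ⟨_, G.colorable_of_fintype⟩
    refine ⟨G.chromaticNumber.toNat, G, ⟨⊥, ?_, bot_le, ?_⟩, (ENat.natCast_toNat hG).symm⟩
    · simp [atMostEdges]
    · simp
  exact Nat.sInf_mem hne

/-- The copy `f` of `G` in the complete graph on `W` contains at most `k` edges of each colour of
the edge colouring `c`. -/
def NoColorMoreThan {V W C : Type*} (k : ℕ) (c : (⊤ : SimpleGraph W).edgeSet → C)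
    {G : SimpleGraph V} (f : SimpleGraph.Copy G (⊤ : SimpleGraph W)) : Prop :=
  ∀ i : C, {e : G.edgeSet | c (f.mapEdgeSet e) = i}.encard ≤ k

/-- Every edge colouring of `K_n` with at least `q` colours (actually used) contains a copy of `G`
in which no colour occurs more than `k` times. -/
def ForcesCopy {V : Type*} (k n : ℕ) (G : SimpleGraph V) (q : ℕ) : Prop :=
  ∀ c : (⊤ : SimpleGraph (Fin n)).edgeSet → ℕ, q ≤ (Set.range c).ncard →
    ∃ f : SimpleGraph.Copy G (⊤ : SimpleGraph (Fin n)), NoColorMoreThan k c f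

/-- The `k`-anti-Ramsey number `AR_k(n, G)`: the smallest `q` such that every edge colouring of
`K_n` with at least `q` colours contains a copy of `G` in which no colour occurs more than `k`
times. -/
noncomputable def antiRamseyNumber {V : Type*} (k n : ℕ) (G : SimpleGraph V) : ℕ :=
  sInf {q : ℕ | ForcesCopy k n G q}

/-- The minimum defining `AR_k(n, G)` is attained. -/
theorem forcesCopy_antiRamseyNumber {V : Type*} (k n : ℕ) (G : SimpleGraph V) :
    ForcesCopy k n G (antiRamseyNumber k n G) := by
  have hne : {q : ℕ | ForcesCopy k n G q}.Nonempty := by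
    refine ⟨Nat.card (⊤ : SimpleGraph (Fin n)).edgeSet + 1, fun c hc => absurd hc ?_⟩
    have h : (Set.range c).ncard ≤ Nat.card (⊤ : SimpleGraph (Fin n)).edgeSet := by
      rw [← Set.image_univ, ← Set.ncard_univ]
      exact Set.ncard_image_le
    omega
  exact Nat.sInf_mem hne

/-! Let `q ≥ 3` be the reduced chromatic number of `G`. Both sides are asymptotic to `(q - 2) / (2 *
q - 2) * n ^ 2`. Lower bound: make a Turán graph with `q - 1` parts rainbow and give all other edges
one new colour. A copy of `G` with at most `k` edges of that colour would become `(q -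
1)`-colourable after their deletion. Upper bound: with more colours than the extremal number of a
large balanced complete `q`-partite graph, one edge per colour yields a rainbow copy of it. Cut its
parts into blocks and choose one per part so that no colour inside a chosen block recurs between
chosen blocks (`exists_block_choice`). Place `G` by a `q`-colouring of `G \ D`: an edge between
parts has a colour of its own, and the edges inside parts lie in `D`, so number at most `k`.
Erdős–Stone then gives the asymptotics. In (ii) the reduced chromatic number is `q` itself. -/

/-! ### Upper bound: from many colours to a copy of `G` -/

/-- At most `N ^ (q - 2)` functions take two prescribed values. -/
theorem card_filter_two_values {q N : ℕ} {i₁ i₂ : Fin q} (h : i₁ ≠ i₂) (j₁ j₂ : Fin N) :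
    (Finset.univ.filter fun σ : Fin q → Fin N => σ i₁ = j₁ ∧ σ i₂ = j₂).card ≤ N ^ (q - 2) := by
  have hsub : (Finset.univ.filter fun σ : Fin q → Fin N => σ i₁ = j₁ ∧ σ i₂ = j₂) ⊆
      Fintype.piFinset (fun i => if i ∈ ({i₁, i₂} : Finset (Fin q)) then
        ({if i = i₁ then j₁ else j₂} : Finset (Fin N)) else Finset.univ) := by
    intro σ hσ
    simp only [Finset.mem_filter, Finset.mem_univ, true_and] at hσ
    rw [Fintype.mem_piFinset]
    intro i
    by_cases h1 : i = i₁
    · simp [h1, hσ.1]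
    · by_cases h2 : i = i₂
      · simp [h2, hσ.2, h.symm]
      · simp [h1, h2]
  refine (Finset.card_le_card hsub).trans_eq ?_
  rw [Fintype.card_piFinset]
  have : ∀ i : Fin q, (if i ∈ ({i₁, i₂} : Finset (Fin q)) then
        ({if i = i₁ then j₁ else j₂} : Finset (Fin N)) else Finset.univ).card =
        if i ∈ ({i₁, i₂} : Finset (Fin q)) then 1 else N := by
    intro i; split_ifs <;> simp
  rw [Finset.prod_congr rfl fun i _ => this i, Finset.prod_ite, Finset.prod_const_one, one_mul,
    Finset.prod_const]
  congr 1
  rw [show (Finset.univ.filter fun i => i ∉ ({i₁, i₂} : Finset (Fin q))) =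
    ({i₁, i₂} : Finset (Fin q))ᶜ by ext; simp, Finset.card_compl, Finset.card_pair h,
    Fintype.card_fin]

/-- If the edges between different parts of a blow-up have pairwise different colours, one can
choose a block of each part such that no colour occurs both inside a chosen block and between two
chosen blocks. -/
theorem exists_block_choice {q N m : ℕ} (hq : 2 ≤ q) (hN : q * m * m < N)
    (γ : Sym2 (Fin q × Fin N × Fin m) → ℕ)
    (hγ : ∀ x y z w : Fin q × Fin N × Fin m, x.1 ≠ y.1 → z.1 ≠ w.1 → γ s(x, y) = γ s(z, w) →
      s(x, y) = s(z, w)) :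
    ∃ σ : Fin q → Fin N, ∀ i a b i₁ a₁ i₂ a₂, i₁ ≠ i₂ →
      γ s((i, σ i, a), (i, σ i, b)) ≠ γ s((i₁, σ i₁, a₁), (i₂, σ i₂, a₂)) := by
  classical
  -- The bad choices for one pair inside one block, whether or not `σ` selects that block. The
  -- pair's colour occurs on at most one edge between parts, which fixes `σ` at two indices; hence
  -- the union bound below.
  let B : Fin q × Fin N × Fin m × Fin m → Finset (Fin q → Fin N) := fun p =>
    Finset.univ.filter fun σ => ∃ i₁ a₁ i₂ a₂, i₁ ≠ i₂ ∧
      γ s((p.1, p.2.1, p.2.2.1), (p.1, p.2.1, p.2.2.2)) = γ s((i₁, σ i₁, a₁), (i₂, σ i₂, a₂))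
  have hB : ∀ p, (B p).card ≤ N ^ (q - 2) := by
    intro p
    rcases (B p).eq_empty_or_nonempty with h | ⟨σ, hσ⟩
    · simp [h]
    · simp only [B, Finset.mem_filter, Finset.mem_univ, true_and] at hσ
      obtain ⟨i₁, a₁, i₂, a₂, hne, hc⟩ := hσ
      refine le_trans (Finset.card_le_card ?_) (card_filter_two_values hne (σ i₁) (σ i₂))
      intro τ hτ
      simp only [B, Finset.mem_filter, Finset.mem_univ, true_and] at hτ ⊢
      obtain ⟨l₁, b₁, l₂, b₂, hne', hc'⟩ := hτ
      have := hγ _ _ _ _ (by exact hne) (by exact hne') (hc.symm.trans hc')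
      rw [Sym2.eq_iff] at this
      simp only [Prod.mk.injEq] at this
      rcases this with ⟨⟨rfl, h1, -⟩, rfl, h2, -⟩ | ⟨⟨rfl, h1, -⟩, rfl, h2, -⟩ <;>
        exact ⟨h1.symm, h2.symm⟩
  have hlt : (Finset.univ.biUnion B).card < (Finset.univ : Finset (Fin q → Fin N)).card := by
    calc (Finset.univ.biUnion B).card
        ≤ (Finset.univ : Finset (Fin q × Fin N × Fin m × Fin m)).card * N ^ (q - 2) :=
          Finset.card_biUnion_le_card_mul _ _ _ fun p _ => hB p
      _ = (q * m * m) * (N * N ^ (q - 2)) := by simp; ring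
      _ < N * (N * N ^ (q - 2)) := by
          have hN0 : 0 < N := by omega
          exact Nat.mul_lt_mul_of_pos_right hN (by positivity)
      _ = N ^ (q - 2 + 2) := by ring
      _ = _ := by simp [Nat.sub_add_cancel hq]
  obtain ⟨σ, -, hσ⟩ := Finset.exists_mem_notMem_of_card_lt_card hlt
  refine ⟨σ, fun i a b i₁ a₁ i₂ a₂ hne hc => hσ ?_⟩
  exact Finset.mem_biUnion.2 ⟨(i, σ i, a, b), Finset.mem_univ _, by
    simp only [B, Finset.mem_filter, Finset.mem_univ, true_and]
    exact ⟨i₁, a₁, i₂, a₂, hne, hc⟩⟩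

/-- A colouring restricted to suitable representatives is rainbow. -/
theorem exists_rainbow_graph {W : Type*} [Fintype W] (c : (⊤ : SimpleGraph W).edgeSet → ℕ) :
    ∃ R : SimpleGraph W, R.edgeSet.ncard = (Set.range c).ncard ∧
      ∀ e₁ e₂ : (⊤ : SimpleGraph W).edgeSet, e₁.1 ∈ R.edgeSet → e₂.1 ∈ R.edgeSet →
        c e₁ = c e₂ → e₁ = e₂ := by
  obtain ⟨s, -, hs⟩ := Set.exists_subset_bijOn Set.univ c
  rw [Set.image_univ] at hs
  have hR : (SimpleGraph.fromEdgeSet (Subtype.val '' s)).edgeSet = Subtype.val '' s := by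
    rw [SimpleGraph.edgeSet_fromEdgeSet, sdiff_eq_left, Set.disjoint_left]
    rintro _ ⟨e, -, rfl⟩ he
    exact SimpleGraph.not_isDiag_of_mem_edgeSet _ e.2 (by simpa using he)
  refine ⟨SimpleGraph.fromEdgeSet (Subtype.val '' s), ?_, ?_⟩
  · rw [hR, Set.ncard_image_of_injective _ Subtype.val_injective, ← hs.image_eq,
      hs.injOn.ncard_image]
  · rw [hR]
    intro e₁ e₂ h₁ h₂ h
    rw [Subtype.val_injective.mem_set_image] at h₁ h₂
    exact hs.injOn h₁ h₂ h

/-- A rainbow copy of a large complete `q`-partite graph yields the required copy of `G`. -/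
theorem antiRamseyNumber_le_extremalNumber_succ {V : Type*} [Fintype V] {G D : SimpleGraph V}
    {k q n N : ℕ} (hk : 1 ≤ k) (hq : 2 ≤ q) (hD : D.edgeSet.encard ≤ k) (hc : (G \ D).Colorable q)
    (hN : q * Fintype.card V * Fintype.card V < N) :
    antiRamseyNumber k n G ≤
      SimpleGraph.extremalNumber n
        (SimpleGraph.completeEquipartiteGraph q (N * Fintype.card V)) + 1 := by
  classical
  refine Nat.sInf_le fun c hcard => ?_
  obtain ⟨R, hRcard, hR⟩ := exists_rainbow_graph c
  obtain ⟨K⟩ : (SimpleGraph.completeEquipartiteGraph q (N * Fintype.card V)).IsContained R := by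
    refine SimpleGraph.IsContained.of_extremalNumber_lt_card_edgeFinset ?_
    rw [Fintype.card_fin, SimpleGraph.edgeFinset, ← Set.ncard_eq_toFinset_card']
    omega
  obtain ⟨C⟩ := hc
  let m := Fintype.card V
  let κ : Fin q × Fin N × Fin m → Fin n := fun x => K (x.1, finProdFinEquiv x.2)
  have hκ : Function.Injective κ := by
    rintro ⟨a, b⟩ ⟨a', b'⟩ h
    simpa using K.injective h
  -- Diagonal pairs get the junk colour `0`, which only adds conditions on the choice of blocks.
  let c' : Sym2 (Fin n) → ℕ := fun e => if h : e ∈ (⊤ : SimpleGraph (Fin n)).edgeSet then c ⟨e, h⟩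
    else 0
  have hc' : ∀ e (h : e ∈ (⊤ : SimpleGraph (Fin n)).edgeSet), c ⟨e, h⟩ = c' e := fun e h => by
    simp only [c', dif_pos h]
  have hrain : ∀ x y z w : Fin q × Fin N × Fin m, x.1 ≠ y.1 → z.1 ≠ w.1 →
      c' s(κ x, κ y) = c' s(κ z, κ w) → s(x, y) = s(z, w) := by
    intro x y z w hxy hzw h
    have h1 : R.Adj (κ x) (κ y) := K.toHom.map_adj (by simpa using hxy)
    have h2 : R.Adj (κ z) (κ w) := K.toHom.map_adj (by simpa using hzw)
    rw [← hc' _ (by simpa using h1.ne), ← hc' _ (by simpa using h2.ne)] at h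
    have := congrArg Subtype.val (hR _ _ (by exact h1) (by exact h2) h)
    exact Sym2.map.injective hκ this
  obtain ⟨σ, hσ⟩ := exists_block_choice hq hN (fun e => c' (e.map κ))
    fun x y z w hxy hzw h => hrain x y z w hxy hzw h
  let ι : V → Fin q × Fin N × Fin m := fun v => (C v, σ (C v), Fintype.equivFin V v)
  have hι : Function.Injective ι := fun v w h => by
    simp only [ι, Prod.mk.injEq] at h
    exact (Fintype.equivFin V).injective h.2.2
  let f : SimpleGraph.Copy G (⊤ : SimpleGraph (Fin n)) :=
    ⟨⟨fun v => κ (ι v), fun {a b} h => by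
      simpa using fun h' => h.ne (hι (hκ h'))⟩, hκ.comp hι⟩
  have hf : ∀ v w (h : s(v, w) ∈ G.edgeSet),
      c (f.mapEdgeSet ⟨s(v, w), h⟩) = c' s(κ (ι v), κ (ι w)) := fun v w h => hc' _ _
  refine ⟨f, fun i => ?_⟩
  -- A colour on an edge between parts occurs only once in the copy; any other colour is confined to
  -- `D`.
  by_cases hcross : ∃ v w, ∃ h : s(v, w) ∈ G.edgeSet, C v ≠ C w ∧
      c (f.mapEdgeSet ⟨s(v, w), h⟩) = i
  · obtain ⟨v, w, h, hne, hi⟩ := hcross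
    have hsub : {e : G.edgeSet | c (f.mapEdgeSet e) = i} ⊆ {⟨s(v, w), h⟩} := by
      rintro ⟨e, he⟩ hei
      induction e using Sym2.ind with | _ v' w' =>
      change c _ = i at hei
      have heq : c' s(κ (ι v'), κ (ι w')) = c' s(κ (ι v), κ (ι w)) := by
        rw [← hf _ _ he, ← hf _ _ h, hei, hi]
      by_cases hvw : C v' = C w'
      · exfalso
        refine hσ (C v') (Fintype.equivFin V v') (Fintype.equivFin V w') (C v)
          (Fintype.equivFin V v) (C w) (Fintype.equivFin V w) hne ?_
        simp only [Sym2.map_mk]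
        convert heq using 4
        simp only [ι, hvw]
      · have := hrain (ι v') (ι w') (ι v) (ι w) hvw hne heq
        simp only [Set.mem_singleton_iff, Subtype.mk.injEq]
        exact Sym2.map.injective hι this
    refine (Set.encard_le_encard hsub).trans ?_
    rw [Set.encard_singleton]
    exact_mod_cast hk
  · push Not at hcross
    refine le_trans ?_ hD
    rw [← Subtype.val_injective.encard_image]
    refine Set.encard_le_encard ?_
    rintro _ ⟨⟨e, he⟩, hei, rfl⟩
    induction e using Sym2.ind with | _ v w =>
    by_contra hnD
    exact hcross v w he (C.valid ⟨he, hnD⟩) hei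

/-! ### The reduced chromatic number -/

/-- The copies of the complete graph in which one takes the `j`-th vertex of every part are
edge-disjoint, so few edges cannot meet all of them. -/
theorem le_of_colorable_sdiff {V : Type*} {G D : SimpleGraph V} {q k m : ℕ}
    (hG : (SimpleGraph.completeEquipartiteGraph q (k + 1)).IsContained G)
    (hD : D.edgeSet.encard ≤ k) (hm : (G \ D).Colorable m) : q ≤ m := by
  obtain ⟨f⟩ := hG
  by_cases h : ∃ j, ∀ i i', i ≠ i' → ¬ D.Adj (f (i, j)) (f (i', j))
  · obtain ⟨j, hj⟩ := h
    let g : (⊤ : SimpleGraph (Fin q)) →g G \ D :=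
      ⟨fun i => f (i, j), fun {a b} hab =>
        ⟨f.toHom.map_adj (by simpa using hab), hj a b (by simpa using hab)⟩⟩
    have := hm.of_hom g
    simpa using this.card_le_of_pairwise_adj (f := id) (fun a b h => by simpa using h)
  · push Not at h
    choose i i' hne hadj using h
    exfalso
    have hinj : Function.Injective fun j => s(f (i j, j), f (i' j, j)) := by
      intro j l hjl
      simp only [Sym2.eq_iff] at hjl
      rcases hjl with ⟨h, -⟩ | ⟨h, -⟩ <;> simpa using (Prod.ext_iff.1 (f.injective h)).2
    have h1 : (Set.range fun j => s(f (i j, j), f (i' j, j))) ⊆ D.edgeSet := by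
      rintro _ ⟨j, rfl⟩
      exact hadj j
    have h2 := (Set.encard_le_encard h1).trans hD
    rw [← Set.image_univ, hinj.encard_image, Set.encard_univ, ENat.card_eq_coe_fintype_card,
      Fintype.card_fin] at h2
    have : k + 1 ≤ k := by exact_mod_cast h2
    omega

theorem exists_colorable_sdiff {V : Type*} [Finite V] (k : ℕ) (G : SimpleGraph V) :
    ∃ D ≤ G, D.edgeSet.encard ≤ k ∧
      (G \ D).Colorable (reducedChromaticNumber (atMostEdges k V) G) := by
  obtain ⟨H, ⟨D, hD, hDG, rfl⟩, hH⟩ := reducedChromaticNumber_attained k G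
  exact ⟨D, hDG, hD, SimpleGraph.chromaticNumber_le_iff_colorable.1 hH.le⟩

theorem reducedChromaticNumber_le {V : Type*} {k m : ℕ} {G D : SimpleGraph V} (hDG : D ≤ G)
    (hD : D.edgeSet.encard ≤ k) (hm : (G \ D).Colorable m) :
    reducedChromaticNumber (atMostEdges k V) G ≤ m := by
  have hle := hm.chromaticNumber_le
  obtain ⟨l, hl⟩ := ENat.ne_top_iff_exists.1 (ne_top_of_le_ne_top (ENat.natCast_ne_top m) hle)
  have hlm : l ≤ m := by rw [← hl] at hle; exact_mod_cast hle
  have hmem : l ∈ {m : ℕ | ∃ H ∈ deck (atMostEdges k V) G, H.chromaticNumber = m} :=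
    ⟨G \ D, ⟨D, hD, hDG, rfl⟩, hl.symm⟩
  exact (Nat.sInf_le hmem).trans hlm

theorem three_le_reducedChromaticNumber {V : Type*} [Finite V] {k : ℕ} {G : SimpleGraph V}
    (h : ∀ S : Finset (Sym2 V), (S : Set (Sym2 V)) ⊆ G.edgeSet → S.card ≤ k →
      ¬ (G.deleteEdges (S : Set (Sym2 V))).IsBipartite) :
    3 ≤ reducedChromaticNumber (atMostEdges k V) G := by
  obtain ⟨D, hDG, hD, hc⟩ := exists_colorable_sdiff k G
  by_contra! hlt
  have hfin : D.edgeSet.Finite := Set.toFinite _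
  refine h hfin.toFinset (by simpa using hDG) ?_ ?_
  · rw [hfin.encard_eq_coe_toFinset_card] at hD
    exact_mod_cast hD
  · rw [Set.Finite.coe_toFinset, SimpleGraph.deleteEdges_edgeSet]
    exact hc.mono (by omega)

theorem reducedChromaticNumber_eq {V : Type*} [Finite V] {k q : ℕ} {G : SimpleGraph V}
    (hχ : G.chromaticNumber = q)
    (hG : (SimpleGraph.completeEquipartiteGraph q (k + 1)).IsContained G) :
    reducedChromaticNumber (atMostEdges k V) G = q := by
  obtain ⟨D, -, hD, hc⟩ := exists_colorable_sdiff k G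
  refine le_antisymm ?_ (le_of_colorable_sdiff hG hD hc)
  exact reducedChromaticNumber_le (D := ⊥) bot_le (by simp)
    (by simpa using SimpleGraph.chromaticNumber_le_iff_colorable.1 hχ.le)

/-! ### Lower bound: the Turán colouring -/

/-- Colour `T` rainbow and all remaining edges with one further colour. -/
theorem ncard_edgeSet_lt_antiRamseyNumber {V : Type*} [Finite V] {G : SimpleGraph V} {k n m : ℕ}
    (T : SimpleGraph (Fin n)) (hT : T.Colorable m)
    (hm : m < reducedChromaticNumber (atMostEdges k V) G) :
    T.edgeSet.ncard < antiRamseyNumber k n G := by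
  classical
  by_contra! hle
  have : Encodable (Sym2 (Fin n)) := Fintype.toEncodable _
  let c : (⊤ : SimpleGraph (Fin n)).edgeSet → ℕ := fun e =>
    if e.1 ∈ T.edgeSet then Encodable.encode e.1 + 1 else 0
  have hinc : ∀ e (he : e ∈ T.edgeSet), e ∈ (⊤ : SimpleGraph (Fin n)).edgeSet := fun e he =>
    SimpleGraph.edgeSet_mono le_top he
  have hcard : T.edgeSet.ncard ≤ (Set.range c).ncard := by
    refine Set.ncard_le_ncard_of_injOn (fun e => Encodable.encode e + 1) ?_ ?_ (Set.toFinite _)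
    · intro e he
      exact ⟨⟨e, hinc e he⟩, if_pos he⟩
    · intro e _ e' _ h
      simpa using h
  obtain ⟨f, hf⟩ := forcesCopy_antiRamseyNumber k n G c (hle.trans hcard)
  -- The deleted edges are those that `f` sends outside `T`, all of colour `0`.
  have hcol : (G \ (G \ T.comap f)).Colorable m := by
    refine hT.of_hom (⟨f, fun {a b} h => ?_⟩ : G \ (G \ T.comap f) →g T)
    by_contra hab
    exact h.2 ⟨h.1, hab⟩
  refine absurd (reducedChromaticNumber_le sdiff_le ?_ hcol) hm.not_ge
  refine le_trans ?_ (hf 0)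
  rw [← Subtype.val_injective.encard_image]
  refine Set.encard_le_encard fun e he => ?_
  induction e using Sym2.ind with | _ v w =>
  exact ⟨⟨s(v, w), he.1⟩, if_neg he.2, rfl⟩

theorem extremalNumber_top_eq_ncard {q : ℕ} (hq : 2 ≤ q) (n : ℕ) :
    SimpleGraph.extremalNumber n (⊤ : SimpleGraph (Fin q)) =
      (SimpleGraph.turanGraph n (q - 1)).edgeSet.ncard := by
  have : Nontrivial (Fin q) := Fin.nontrivial_iff_two_le.2 hq
  rw [SimpleGraph.extremalNumber_top, SimpleGraph.edgeFinset, ← Set.ncard_eq_toFinset_card',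
    Fintype.card_fin]

theorem extremalNumber_lt_antiRamseyNumber {V : Type*} [Finite V] {G : SimpleGraph V} {k q : ℕ}
    (hq : 2 ≤ q) (hG : q = reducedChromaticNumber (atMostEdges k V) G) (n : ℕ) :
    SimpleGraph.extremalNumber n (⊤ : SimpleGraph (Fin q)) < antiRamseyNumber k n G := by
  rw [extremalNumber_top_eq_ncard hq]
  refine ncard_edgeSet_lt_antiRamseyNumber (m := q - 1) _ ?_ (by omega)
  exact ⟨SimpleGraph.Coloring.mk (fun v => ⟨v % (q - 1), Nat.mod_lt _ (by omega)⟩)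
    fun {v w} h => by simpa [SimpleGraph.turanGraph_adj] using h⟩

/-! ### Asymptotics -/

/-- The edge version of the **Erdős–Stone theorem**. -/
theorem exists_extremalNumber_completeEquipartiteGraph_le {ε : ℝ} (hε : 0 < ε) {r t : ℕ}
    (hr : 1 ≤ r) (ht : 0 < t) :
    ∃ A : ℝ, ∀ n : ℕ, (SimpleGraph.extremalNumber n
      (SimpleGraph.completeEquipartiteGraph (r + 1) t) : ℝ) ≤
        A + (1 - 1 / r + ε) * (n * (n + 1) / 2) := by
  classical
  set H := SimpleGraph.completeEquipartiteGraph (r + 1) t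
  have hH : H ≠ ⊥ := fun h => by
    have := SimpleGraph.completeEquipartiteGraph_eq_bot_iff.1 h
    omega
  have hr' : (0 : ℝ) ≤ 1 - 1 / r + ε := by
    have h1 : (1 : ℝ) ≤ r := by exact_mod_cast hr
    have h2 : 1 / (r : ℝ) ≤ 1 := by rw [div_le_one (by linarith)]; exact h1
    linarith
  obtain ⟨M, hM⟩ := eventually_atTop.1
    (SimpleGraph.eventually_completeEquipartiteGraph_isContained_of_minDegree hε r t)
  -- Delete a vertex of minimum degree from an extremal graph; the minimum-degree form of
  -- Erdős–Stone bounds the loss. Summing gives `n * (n + 1) / 2`, and `A` absorbs the terms up to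
  -- `M`.
  have hstep : ∀ n, M ≤ n + 1 → (SimpleGraph.extremalNumber (n + 1) H : ℝ) ≤
      SimpleGraph.extremalNumber n H + (1 - 1 / r + ε) * (n + 1 : ℕ) := by
    intro n hn
    obtain ⟨E, _, hE⟩ := SimpleGraph.exists_isExtremal_free (V := Fin (n + 1)) hH
    rw [SimpleGraph.isExtremal_free_iff, Fintype.card_fin] at hE
    have hdeg : (E.minDegree : ℝ) < (1 - 1 / r + ε) * (n + 1 : ℕ) := by
      by_contra! h
      exact hE.1 (hM (n + 1) hn h)
    obtain ⟨v, hv⟩ := E.exists_minimal_degree_vertex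
    have h1 := SimpleGraph.card_edgeFinset_deleteIncidenceSet_le_extremalNumber hE.1 v
    rw [SimpleGraph.card_edgeFinset_deleteIncidenceSet, Fintype.card_fin, ← hv, hE.2,
      Nat.add_sub_cancel] at h1
    have h2 : SimpleGraph.extremalNumber (n + 1) H ≤
      SimpleGraph.extremalNumber n H + E.minDegree := by omega
    have h3 : (SimpleGraph.extremalNumber (n + 1) H : ℝ) ≤
      SimpleGraph.extremalNumber n H + E.minDegree := by exact_mod_cast h2
    linarith
  refine ⟨∑ i ∈ Finset.range (M + 1), (SimpleGraph.extremalNumber i H : ℝ), fun n => ?_⟩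
  have hsmall : ∀ n ≤ M, (SimpleGraph.extremalNumber n H : ℝ) ≤
      ∑ i ∈ Finset.range (M + 1), (SimpleGraph.extremalNumber i H : ℝ) := fun n hn =>
    Finset.single_le_sum (f := fun i => (SimpleGraph.extremalNumber i H : ℝ))
      (fun i _ => Nat.cast_nonneg _) (Finset.mem_range.2 (by omega))
  induction n with
  | zero => simpa using hsmall 0 (Nat.zero_le _)
  | succ n ih =>
    by_cases hn : n + 1 ≤ M
    · have : (0 : ℝ) ≤ (1 - 1 / r + ε) * (((n + 1 : ℕ) : ℝ) * (((n + 1 : ℕ) : ℝ) + 1) / 2) := by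
        positivity
      linarith [hsmall (n + 1) hn]
    · have := hstep n (by omega)
      push_cast at this ⊢
      linear_combination this + ih

theorem tendsto_card_edgeFinset_turanGraph_div_sq {r : ℕ} (hr : 0 < r) :
    Tendsto (fun n : ℕ => ((SimpleGraph.turanGraph n r).edgeFinset.card : ℝ) / (n : ℝ) ^ 2) atTop
      (nhds ((r - 1) / (2 * r))) := by
  have hr' : (0 : ℝ) < r := by exact_mod_cast hr
  have hr1 : (1 : ℝ) ≤ r := by exact_mod_cast hr
  -- The `r ^ 2` bounds the squared remainder, the `- 1` the rounding in the Turán formula.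
  have hlow : ∀ n : ℕ, ((r : ℝ) - 1) / (2 * r) * ((n : ℝ) ^ 2 - (r : ℝ) ^ 2) - 1 ≤
      ((SimpleGraph.turanGraph n r).edgeFinset.card : ℝ) := by
    intro n
    have h1 : (n ^ 2 - (n % r) ^ 2) * (r - 1) < 
        2 * r * ((SimpleGraph.turanGraph n r).edgeFinset.card + 1) := by
      rw [SimpleGraph.card_edgeFinset_turanGraph]
      calc _ < 2 * r * ((n ^ 2 - (n % r) ^ 2) * (r - 1) / (2 * r) + 1) :=
            Nat.lt_mul_div_succ _ (by positivity)
        _ ≤ _ := by gcongr; omega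
    have h2 : (n % r) ^ 2 ≤ n ^ 2 := Nat.pow_le_pow_left (Nat.mod_le _ _) 2
    have h3 : (((n : ℝ) ^ 2 - ((n % r : ℕ) : ℝ) ^ 2) * (r - 1)) <
        2 * r * ((SimpleGraph.turanGraph n r).edgeFinset.card + 1) := by
      have := (Nat.cast_lt (α := ℝ)).2 h1
      rw [Nat.cast_mul, Nat.cast_sub h2, Nat.cast_sub hr] at this
      push_cast at this ⊢
      exact this
    have h4 : ((n % r : ℕ) : ℝ) ^ 2 ≤ (r : ℝ) ^ 2 := by
      have : ((n % r : ℕ) : ℝ) ≤ r := by exact_mod_cast (Nat.mod_lt n hr).le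
      gcongr
    have h5 : ((n : ℝ) ^ 2 - (r : ℝ) ^ 2) * (r - 1) ≤
        2 * r * ((SimpleGraph.turanGraph n r).edgeFinset.card + 1) := by
      refine le_trans ?_ h3.le
      have : (0 : ℝ) ≤ r - 1 := by linarith
      gcongr
    rw [sub_le_iff_le_add, div_mul_eq_mul_div, div_le_iff₀ (by positivity)]
    linarith
  have hup : ∀ n : ℕ, ((SimpleGraph.turanGraph n r).edgeFinset.card : ℝ) ≤
      ((r : ℝ) - 1) / (2 * r) * (n : ℝ) ^ 2 := by
    intro n
    have := (Nat.cast_le (α := ℝ)).2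
      (SimpleGraph.mul_card_edgeFinset_turanGraph_le (n := n) (r := r))
    rw [Nat.cast_mul, Nat.cast_mul, Nat.cast_mul, Nat.cast_sub hr] at this
    push_cast at this
    rw [div_mul_eq_mul_div, le_div_iff₀ (by positivity)]
    linarith
  set L : ℝ := ((r : ℝ) - 1) / (2 * r)
  have hinv : Tendsto (fun n : ℕ => ((n : ℝ) ^ 2)⁻¹) atTop (nhds 0) :=
    ((tendsto_pow_atTop two_ne_zero).comp tendsto_natCast_atTop_atTop).inv_tendsto_atTop
  refine tendsto_of_tendsto_of_tendsto_of_le_of_le'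
    (g := fun n : ℕ => L - (L * (r : ℝ) ^ 2 + 1) * ((n : ℝ) ^ 2)⁻¹) (h := fun _ => L) ?_
    tendsto_const_nhds ?_ ?_
  · simpa using (hinv.const_mul (L * (r : ℝ) ^ 2 + 1)).const_sub L
  · filter_upwards [eventually_gt_atTop 0] with n hn
    have hn' : (0 : ℝ) < (n : ℝ) ^ 2 := by positivity
    rw [le_div_iff₀ hn', sub_mul, mul_assoc, inv_mul_cancel₀ hn'.ne']
    linarith [hlow n]
  · filter_upwards [eventually_gt_atTop 0] with n hn
    have hn' : (0 : ℝ) < (n : ℝ) ^ 2 := by positivity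
    rw [div_le_iff₀ hn']
    exact hup n

theorem isEquivalent_mul_sq_of_tendsto {f : ℕ → ℝ} {L : ℝ} (hL : L ≠ 0)
    (h : Tendsto (fun n : ℕ => f n / (n : ℝ) ^ 2) atTop (nhds L)) :
    f ~[atTop] fun n : ℕ => L * (n : ℝ) ^ 2 := by
  have hz : ∀ᶠ n : ℕ in atTop, L * (n : ℝ) ^ 2 ≠ 0 := by
    filter_upwards [eventually_gt_atTop 0] with n hn
    positivity
  rw [isEquivalent_iff_tendsto_one hz]
  have := h.div_const L
  rw [div_self hL] at this
  refine this.congr fun n => ?_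
  simp only [Pi.div_apply]
  rw [div_div, mul_comm]

theorem tendsto_extremalNumber_top_div_sq {q : ℕ} (hq : 2 ≤ q) :
    Tendsto (fun n : ℕ => (SimpleGraph.extremalNumber n (⊤ : SimpleGraph (Fin q)) : ℝ) /
      (n : ℝ) ^ 2) atTop (nhds (((q : ℝ) - 2) / (2 * (q : ℝ) - 2))) := by
  have h := tendsto_card_edgeFinset_turanGraph_div_sq (r := q - 1) (by omega)
  rw [Nat.cast_sub (by omega : 1 ≤ q)] at h
  convert h using 2
  · rw [extremalNumber_top_eq_ncard hq, SimpleGraph.edgeFinset, Set.ncard_eq_toFinset_card']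
  · push_cast
    ring

theorem tendsto_antiRamseyNumber_div_sq {V : Type*} [Fintype V] {G : SimpleGraph V} {k q : ℕ}
    (hk : 1 ≤ k) (hq : 3 ≤ q) (hG : q = reducedChromaticNumber (atMostEdges k V) G) :
    Tendsto (fun n : ℕ => (antiRamseyNumber k n G : ℝ) / (n : ℝ) ^ 2) atTop
      (nhds (((q : ℝ) - 2) / (2 * (q : ℝ) - 2))) := by
  obtain ⟨D, -, hD, hc⟩ := exists_colorable_sdiff k G
  rw [← hG] at hc
  have hV : 0 < Fintype.card V := by
    rw [Fintype.card_pos_iff]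
    by_contra hV
    rw [not_nonempty_iff] at hV
    have := reducedChromaticNumber_le (k := k) (G := G) (D := ⊥) bot_le (by simp)
      (SimpleGraph.Colorable.of_isEmpty 0)
    omega
  obtain ⟨r, rfl⟩ : ∃ r, q = r + 1 := ⟨q - 1, by omega⟩
  have hr : (2 : ℝ) ≤ r := by exact_mod_cast (by omega : 2 ≤ r)
  set N := (r + 1) * Fintype.card V * Fintype.card V + 1
  set L : ℝ := (((r + 1 : ℕ) : ℝ) - 2) / (2 * ((r + 1 : ℕ) : ℝ) - 2)
  have hL : 1 - 1 / (r : ℝ) = 2 * L := by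
    simp only [L]
    push_cast
    have : (r : ℝ) ≠ 0 := by positivity
    rw [show 2 * ((r : ℝ) + 1) - 2 = 2 * r by ring]
    field_simp
    ring
  have hlow := tendsto_extremalNumber_top_div_sq (q := r + 1) (by omega)
  refine tendsto_order.2 ⟨fun a ha => ?_, fun a ha => ?_⟩
  · filter_upwards [hlow.eventually_const_lt ha] with n hn
    refine hn.trans_le ?_
    gcongr
    exact (extremalNumber_lt_antiRamseyNumber (by omega) hG n).le
  -- With `ε = a - L` the upper bound tends to `(2 * L + (a - L)) / 2 = (L + a) / 2 < a`.
  · obtain ⟨A, hA⟩ := exists_extremalNumber_completeEquipartiteGraph_le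
      (r := r) (t := N * Fintype.card V) (sub_pos.2 ha) (by omega) (by positivity)
    rw [hL] at hA
    have hinv : Tendsto (fun n : ℕ => ((n : ℝ))⁻¹) atTop (nhds 0) :=
      tendsto_natCast_atTop_atTop.inv_tendsto_atTop
    have hlim : Tendsto (fun n : ℕ => (A + 1) * ((n : ℝ)⁻¹ * (n : ℝ)⁻¹) +
        (2 * L + (a - L)) / 2 * (1 + (n : ℝ)⁻¹)) atTop (nhds ((L + a) / 2)) := by
      convert ((hinv.mul hinv).const_mul (A + 1)).add
        ((hinv.const_add 1).const_mul ((2 * L + (a - L)) / 2)) using 2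
      ring
    filter_upwards [hlim.eventually_lt_const (by linarith : (L + a) / 2 < a),
      eventually_gt_atTop 0] with n hn hn0
    refine lt_of_le_of_lt ?_ hn
    have hn' : (0 : ℝ) < n := by exact_mod_cast hn0
    have h1 := (Nat.cast_le (α := ℝ)).2 (antiRamseyNumber_le_extremalNumber_succ (n := n) (N := N)
      hk (by omega) hD hc (Nat.lt_succ_self _))
    rw [div_le_iff₀ (by positivity)]
    push_cast at h1
    refine (h1.trans (add_le_add_left (hA n) 1)).trans_eq ?_
    field_simp
    ring

theorem theoremt {V : Type*} [Fintype V] (G : SimpleGraph V) (k : ℕ) (hk : 1 ≤ k) :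
    ((∀ S : Finset (Sym2 V), (S : Set (Sym2 V)) ⊆ G.edgeSet → S.card ≤ k →
        ¬ (G.deleteEdges (S : Set (Sym2 V))).IsBipartite) →
      (fun n : ℕ => (antiRamseyNumber k n G : ℝ)) ~[atTop]
        (fun n : ℕ => (SimpleGraph.extremalNumber n
          (⊤ : SimpleGraph (Fin (reducedChromaticNumber (atMostEdges k V) G))) : ℝ))) ∧
    (∀ q : ℕ, 3 ≤ q → G.chromaticNumber = q →
      (SimpleGraph.completeEquipartiteGraph q (k + 1)).IsContained G →
      (fun n : ℕ => (antiRamseyNumber k n G : ℝ)) ~[atTop]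
        (fun n : ℕ => (SimpleGraph.extremalNumber n (⊤ : SimpleGraph (Fin q)) : ℝ)) ∧
      (fun n : ℕ => (antiRamseyNumber k n G : ℝ)) ~[atTop]
        (fun n : ℕ => ((q : ℝ) - 2) / (2 * (q : ℝ) - 2) * (n : ℝ) ^ 2)) := by
  have hmain : ∀ q : ℕ, 3 ≤ q → q = reducedChromaticNumber (atMostEdges k V) G →
      (fun n : ℕ => (antiRamseyNumber k n G : ℝ)) ~[atTop]
        (fun n : ℕ => (SimpleGraph.extremalNumber n (⊤ : SimpleGraph (Fin q)) : ℝ)) ∧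
      (fun n : ℕ => (antiRamseyNumber k n G : ℝ)) ~[atTop]
        (fun n : ℕ => ((q : ℝ) - 2) / (2 * (q : ℝ) - 2) * (n : ℝ) ^ 2) := by
    intro q hq hG
    have hq' : (3 : ℝ) ≤ q := by exact_mod_cast hq
    have hL : ((q : ℝ) - 2) / (2 * (q : ℝ) - 2) ≠ 0 :=
      (div_pos (by linarith) (by linarith)).ne'
    have h1 := isEquivalent_mul_sq_of_tendsto hL (tendsto_antiRamseyNumber_div_sq hk hq hG)
    have h2 := isEquivalent_mul_sq_of_tendsto hL (tendsto_extremalNumber_top_div_sq (by omega))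
    exact ⟨h1.trans h2.symm, h1⟩
  refine ⟨fun h => (hmain _ (three_le_reducedChromaticNumber h) rfl).1, fun q hq hχ hG => ?_⟩
  exact hmain q hq (reducedChromaticNumber_eq hχ hG).symm
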